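/- Let $\mathcal H$ and $\mathcal G$ be real Hilbert spaces. For a set-valued operator $A\colon\mathcal H\to 2^{\mathcal H}$, write $\operatorname{dom}A=\{x : Ax\neq\varnothing\}$, $\operatorname{ran}A=\bigcup_{x}Ax$, and let $A^{-1}$ be the operator with $x\in A^{-1}u\Leftrightarrow u\in Ax$. Call $A$ at most single-valued if each $Ax$ has at most one element; injective if $Ax_1\cap Ax_2\neq\varnothing$ implies $x_1=x_2$; and maximally monotone if, for all $x_1,u_1\in\mathcal H$, one has $u_1\in Ax_1$ if and only if $\langle x_1-x_2,\,u_1-u_2\rangle\ge 0$ for every $x_2\in\mathcal H$ and every $u_2\in Ax_2$. The same definitions apply in $\mathcal G$. For a bounded linear operator $L\colon\mathcal H\to\mathcal G$ and $B\colon\mathcal G\to 2^{\mathcal G}$, the resolvent composition of $B$ with $L$ is $$L\diamond B=\bigl(L^*\circ(B+\mathrm{Id}_{\mathcal G})^{-1}\circ L\bigr)^{-1}-\mathrm{Id}_{\mathcal H},$$ and the resolvent cocomposition of $B$ with $L$ is $L\mathbin{\blacklozenge}B=\bigl(L\diamond B^{-1}\bigr)^{-1}$. **Theorem.** Suppose that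 $\|L\|\le 1$ and that $B$ is maximally monotone. Then the following hold: 1. $L\diamond B$ is maximally monotone. 2. $L\mathbin{\blacklozenge}B$ is maximally monotone. 3. If $L$ is injective and $B$ is at most single-valued, then $L\diamond B$ is at most single-valued. 4. If $L$ and $B$ are injective, then $L\diamond B$ is injective. 5. $\operatorname{int}\operatorname{dom}(L\diamond B)=\operatorname{int}L^*(\operatorname{dom}B)$. 6. $\overline{\operatorname{dom}(L\diamond B)}=\overline{L^*(\operatorname{dom}B)}$. 7. $\operatorname{int}\operatorname{ran}(L\diamond B)=\operatorname{int}\bigl(\operatorname{ran}(\mathrm{Id}_{\mathcal H}-L^*\circ L)+L^*(\operatorname{ran}B)\bigr)$. 8. $\overline{\operatorname{ran}(L\diamond B)}=\overline{\operatorname{ran}(\mathrm{Id}_{\mathcal H}-L^*\circ L)+L^*(\operatorname{ran}B)}$. 9. $\operatorname{int}\operatorname{dom}(L\mathbin{\blacklozenge}B)=\operatorname{int}\bigl(\operatorname{ran}(\mathrm{Id}_{\mathcal H}-L^*\circ L)+L^*(\operatorname{dom}B)\bigr)$. 10. $\overline{\operatorname{dom}(L\mathbin{\blacklozenge}B)}=\overline{\operatorname{ran}(\mathrm{Id}_{\mathcal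 H}-L^*\circ L)+L^*(\operatorname{dom}B)}$. 11. $\operatorname{int}\operatorname{ran}(L\mathbin{\blacklozenge}B)=\operatorname{int}L^*(\operatorname{ran}B)$. 12. $\overline{\operatorname{ran}(L\mathbin{\blacklozenge}B)}=\overline{L^*(\operatorname{ran}B)}$. -/

import Mathlib

open scoped Pointwise

/-- A set-valued operator from `X` to `2^Y`. Sums and differences of such operators are the
pointwise Minkowski sums and differences of their values. -/
abbrev SetOp (X Y : Type*) := X → Set Y

namespace SetOp

/-- The graph of a set-valued operator. -/
def graph {X Y : Type*} (A : SetOp X Y) : Set (X × Y) := {p | p.2 ∈ A p.1}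

/-- The domain: the points at which the value is nonempty. -/
def domain {X Y : Type*} (A : SetOp X Y) : Set X := {x | (A x).Nonempty}

/-- The range: the union of all the values. -/
def ran {X Y : Type*} (A : SetOp X Y) : Set Y := {y | ∃ x, y ∈ A x}

/-- The set-valued inverse, whose graph is the transposed graph. -/
def inverse {X Y : Type*} (A : SetOp X Y) : SetOp Y X := fun y => {x | y ∈ A x}

/-- A map seen as a set-valued operator with singleton values. -/
def ofMap {X Y : Type*} (f : X → Y) : SetOp X Y := fun x => {f x}

/-- The identity operator. -/
def ident (X : Type*) : SetOp X X := ofMap id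

/-- The composition of set-valued operators: `A ∘ B` sends `x` to the union of the `A y`,
`y ∈ B x`. -/
def comp {X Y Z : Type*} (A : SetOp Y Z) (B : SetOp X Y) : SetOp X Z := fun x => ⋃ y ∈ B x, A y

/-- Each value has at most one element. -/
def AtMostSingleValued {X Y : Type*} (A : SetOp X Y) : Prop := ∀ x, (A x).Subsingleton

/-- Values at distinct points are disjoint. -/
def IsInjective {X Y : Type*} (A : SetOp X Y) : Prop :=
  ∀ x₁ x₂, (A x₁ ∩ A x₂).Nonempty → x₁ = x₂

/-- Maximal monotonicity: `(x₁, u₁)` belongs to the graph if and only if it is monotonically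
related to every point of the graph. -/
def IsMaximallyMonotone {H : Type*} [NormedAddCommGroup H] [InnerProductSpace ℝ H]
    (A : SetOp H H) : Prop :=
  ∀ x₁ u₁ : H, (x₁, u₁) ∈ A.graph ↔ ∀ p ∈ A.graph, 0 ≤ inner ℝ (x₁ - p.1) (u₁ - p.2)

section Compositions

variable {H G : Type*} [NormedAddCommGroup H] [InnerProductSpace ℝ H] [CompleteSpace H]
  [NormedAddCommGroup G] [InnerProductSpace ℝ G] [CompleteSpace G]

/-- The parallel composition `L* ▷ B = (L* ∘ B⁻¹ ∘ L)⁻¹`. -/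
noncomputable def parallelComp (L : H →L[ℝ] G) (B : SetOp G G) : SetOp H H :=
  inverse (comp (ofMap (ContinuousLinearMap.adjoint L)) (comp (inverse B) (ofMap L)))

/-- The resolvent composition of `B` with `L`: the parallel composition `L* ▷ (B + Id)`
minus `Id`. -/
noncomputable def resolventComp (L : H →L[ℝ] G) (B : SetOp G G) : SetOp H H :=
  parallelComp L (B + ident G) - ident H

/-- The resolvent cocomposition of `B` with `L`: the inverse of the resolvent composition of
`B⁻¹` with `L`. -/
noncomputable def resolventCocomp (L : H →L[ℝ] G) (B : SetOp G G) : SetOp H H :=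
  inverse (resolventComp L (inverse B))

end Compositions

end SetOp

/-! By Minty's theorem the resolvent `J` of `B` is an everywhere defined firmly nonexpansive map.
The resolvent of L ⋄ B is T = L* ∘ J ∘ L (`mem_resolventComp_iff`), again firmly nonexpansive
because ‖L‖ ≤ 1, and an operator with such a resolvent is maximally monotone.

Domain and range of L ⋄ B are the ranges of T and Id − T = (Id − L*L) + L*(Id − J)L, visibly
contained in the sets of the theorem. Every y in those larger sets keeps ⟨x, Tx − y⟩ (or its
analogue for Id − T) bounded below in x, and the Brezis–Haraux argument then gives equal interiors
and closures. The cocomposition follows by passing to B⁻¹. -/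

open Filter Topology

namespace SetOp

/-! ### Minty's theorem, by minimising over the lifted graph. -/

section Minty

variable {G : Type*} [NormedAddCommGroup G] [InnerProductSpace ℝ G]

lemma IsMaximallyMonotone.monotone {B : SetOp G G} (hB : IsMaximallyMonotone B) {a b c d : G}
    (h₁ : b ∈ B a) (h₂ : d ∈ B c) : 0 ≤ inner ℝ (a - c) (b - d) :=
  (hB a b).1 h₁ (c, d) h₂

lemma IsMaximallyMonotone.graph_nonempty {B : SetOp G G} (hB : IsMaximallyMonotone B) :
    B.graph.Nonempty := by
  by_contra h
  rw [Set.not_nonempty_iff_eq_empty] at h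
  have := (hB 0 0).2 (by simp [h])
  simp [h] at this

lemma IsMaximallyMonotone.inverse {B : SetOp G G} (hB : IsMaximallyMonotone B) :
    IsMaximallyMonotone (inverse B) := by
  intro u x
  refine (hB x u).trans ⟨fun h p hp => ?_, fun h p hp => ?_⟩
  · rw [real_inner_comm]; exact h (p.2, p.1) hp
  · rw [real_inner_comm]; exact h (p.2, p.1) hp

/-- The convex hull of the graph of `B`, each point `(a, b)` lifted to the height `⟪a, b⟫`. -/
def liftedHull (B : SetOp G G) : Set (G × G × ℝ) :=
  convexHull ℝ ((fun p : G × G => (p.1, p.2, inner ℝ p.1 p.2)) '' B.graph)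

lemma convex_inner_add_inner_le (p q : G) (r : ℝ) :
    Convex ℝ {k : G × G × ℝ | inner ℝ p k.2.1 + inner ℝ k.1 q ≤ r + k.2.2} := by
  rintro ⟨a, b, s⟩ h ⟨a', b', s'⟩ h' t t' ht ht' htt
  simp only [Set.mem_ofPred_eq, Prod.smul_mk, Prod.mk_add_mk, inner_add_right, inner_add_left,
    inner_smul_left, inner_smul_right, smul_eq_mul, RCLike.conj_to_real] at *
  have := add_le_add (mul_le_mul_of_nonneg_left h ht) (mul_le_mul_of_nonneg_left h' ht')
  have e : t * (r + s) + t' * (r + s') = r + (t * s + t' * s') := by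
    linear_combination r * htt
  linarith

/-- Monotonicity between two graph points is affine in each lifted point separately, so it extends
to the hull one variable at a time; the diagonal gives the claim. -/
lemma IsMaximallyMonotone.inner_le_of_mem_liftedHull {B : SetOp G G} (hB : IsMaximallyMonotone B)
    {k : G × G × ℝ} (hk : k ∈ liftedHull B) : inner ℝ k.1 k.2.1 ≤ k.2.2 := by
  have key : ∀ a b, b ∈ B a → inner ℝ a k.2.1 + inner ℝ k.1 b ≤ inner ℝ a b + k.2.2 := by
    intro a b hab
    refine convexHull_min ?_ (convex_inner_add_inner_le a b (inner ℝ a b)) hk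
    rintro _ ⟨⟨c, d⟩, hcd, rfl⟩
    have := hB.monotone hab hcd
    simp only [inner_sub_left, inner_sub_right] at this
    simp only [Set.mem_ofPred_eq]
    linarith
  have : inner ℝ k.1 k.2.1 + inner ℝ k.1 k.2.1 ≤ k.2.2 + k.2.2 := by
    refine convexHull_min ?_ (convex_inner_add_inner_le k.1 k.2.1 k.2.2) hk
    rintro _ ⟨⟨a, b⟩, hab, rfl⟩
    have := key a b hab
    simp only [Set.mem_ofPred_eq]
    linarith
  linarith

/-- The height of a point of `G × G × ℝ` plus half its squared norm in `G × G`. -/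
noncomputable def quadHeight (k : G × G × ℝ) : ℝ := k.2.2 + (‖k.1‖ ^ 2 + ‖k.2.1‖ ^ 2) / 2

lemma quadHeight_convexComb (k g : G × G × ℝ) (t : ℝ) :
    quadHeight ((1 - t) • k + t • g) = quadHeight k
      + t * (g.2.2 - k.2.2 + inner ℝ k.1 (g.1 - k.1) + inner ℝ k.2.1 (g.2.1 - k.2.1))
      + t ^ 2 / 2 * (‖g.1 - k.1‖ ^ 2 + ‖g.2.1 - k.2.1‖ ^ 2) := by
  obtain ⟨p, q, r⟩ := k
  obtain ⟨a, b, s⟩ := g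
  have h : ∀ u v : G, ‖(1 - t) • u + t • v‖ ^ 2
      = ‖u‖ ^ 2 + 2 * t * inner ℝ u (v - u) + t ^ 2 * ‖v - u‖ ^ 2 := by
    intro u v
    have : (1 - t) • u + t • v = u + t • (v - u) := by module
    rw [this, norm_add_sq_real, inner_smul_right, norm_smul, mul_pow, Real.norm_eq_abs, sq_abs]
    ring
  simp only [quadHeight, Prod.smul_mk, Prod.mk_add_mk, h, smul_eq_mul]
  ring

lemma quadHeight_midpoint (k g : G × G × ℝ) :
    quadHeight ((1 - (1 / 2 : ℝ)) • k + (1 / 2 : ℝ) • g) = (quadHeight k + quadHeight g) / 2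
      - (‖g.1 - k.1‖ ^ 2 + ‖g.2.1 - k.2.1‖ ^ 2) / 8 := by
  rw [quadHeight_convexComb]
  simp only [quadHeight, norm_sub_sq_real, inner_sub_right, real_inner_self_eq_norm_sq]
  rw [real_inner_comm g.1, real_inner_comm g.2.1]
  ring

lemma nonneg_of_forall_add_mul_nonneg {D E : ℝ}
    (h : ∀ t : ℝ, 0 < t → t ≤ 1 → 0 ≤ D + t * E) : 0 ≤ D := by
  have h₁ : Tendsto (fun n : ℕ => D + 1 / ((n : ℝ) + 1) * E) atTop (𝓝 (D + 0 * E)) :=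
    (tendsto_one_div_add_atTop_nhds_zero_nat.mul_const E).const_add D
  rw [zero_mul, add_zero] at h₁
  refine ge_of_tendsto' h₁ fun n => h _ Nat.one_div_pos_of_nat ?_
  rw [div_le_one (by positivity)]
  linarith [n.cast_nonneg (α := ℝ)]

lemma cauchySeq_of_sq_le {G : Type*} [NormedAddCommGroup G] {x : ℕ → G}
    (h : ∀ n m N : ℕ, N ≤ n → N ≤ m → ‖x n - x m‖ ^ 2 ≤ 8 * (1 / ((N : ℝ) + 1))) :
    CauchySeq x := by
  refine cauchySeq_of_le_tendsto_0 (fun N : ℕ => √(8 * (1 / ((N : ℝ) + 1))))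
    (fun n m N hn hm => ?_) ?_
  · rw [dist_eq_norm]
    exact Real.le_sqrt_of_sq_le (h n m N hn hm)
  · have := (tendsto_one_div_add_atTop_nhds_zero_nat (𝕜 := ℝ)).const_mul 8
    simpa using this.sqrt

variable [CompleteSpace G]

/-- On the hull `quadHeight` is at least ‖a + b‖²/2, hence has an infimum `m`. Uniform convexity
makes the G × G components of a minimising sequence converge to some (p, q), and first-order
optimality makes (−q, −p) monotonically related to the graph, hence a point of it. Testing at that
point itself gives p = −q. -/
lemma IsMaximallyMonotone.exists_neg_mem {B : SetOp G G} (hB : IsMaximallyMonotone B) :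
    ∃ x, -x ∈ B x := by
  have hconv : Convex ℝ (liftedHull B) := convex_convexHull ℝ _
  have hmem : ∀ a b, b ∈ B a → (a, b, inner ℝ a b) ∈ liftedHull B := fun a b hab =>
    subset_convexHull ℝ _ ⟨(a, b), hab, rfl⟩
  have hcomb : ∀ k ∈ liftedHull B, ∀ g ∈ liftedHull B, ∀ t : ℝ, 0 < t → t ≤ 1 →
      (1 - t) • k + t • g ∈ liftedHull B := fun k hk g hg t h0 h1 =>
    hconv hk hg (by linarith) h0.le (by ring)
  set V := quadHeight '' liftedHull B with hV
  have hbdd : BddBelow V := by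
    refine ⟨0, ?_⟩
    rintro _ ⟨k, hk, rfl⟩
    have h1 := hB.inner_le_of_mem_liftedHull hk
    have h2 := norm_add_sq_real k.1 k.2.1
    have h3 := sq_nonneg ‖k.1 + k.2.1‖
    unfold quadHeight
    linarith
  have hne : V.Nonempty := by
    obtain ⟨⟨a, b⟩, hab⟩ := hB.graph_nonempty
    exact ⟨_, _, hmem a b hab, rfl⟩
  set m := sInf V with hm
  have hle : ∀ k ∈ liftedHull B, m ≤ quadHeight k := fun k hk => csInf_le hbdd ⟨k, hk, rfl⟩
  have hex : ∀ n : ℕ, ∃ k ∈ liftedHull B, quadHeight k < m + 1 / ((n : ℝ) + 1) := by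
    intro n
    obtain ⟨_, ⟨k, hk, rfl⟩, h⟩ := exists_lt_of_csInf_lt hne
      (show sInf V < m + 1 / ((n : ℝ) + 1) from lt_add_of_pos_right _ Nat.one_div_pos_of_nat)
    exact ⟨k, hk, h⟩
  choose k hk hkm using hex
  have hdist : ∀ i j N : ℕ, N ≤ i → N ≤ j →
      ‖(k i).1 - (k j).1‖ ^ 2 + ‖(k i).2.1 - (k j).2.1‖ ^ 2 ≤ 8 * (1 / ((N : ℝ) + 1)) := by
    intro i j N hi hj
    have h := hle _ (hcomb _ (hk j) _ (hk i) (1 / 2) (by norm_num) (by norm_num))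
    rw [quadHeight_midpoint] at h
    have h1 := hkm i
    have h2 := hkm j
    have h3 : 1 / ((i : ℝ) + 1) ≤ 1 / ((N : ℝ) + 1) := Nat.one_div_le_one_div hi
    have h4 : 1 / ((j : ℝ) + 1) ≤ 1 / ((N : ℝ) + 1) := Nat.one_div_le_one_div hj
    linarith
  obtain ⟨p, hp⟩ := cauchySeq_tendsto_of_complete (cauchySeq_of_sq_le (x := fun n => (k n).1)
    fun i j N hi hj => by linarith [hdist i j N hi hj, sq_nonneg ‖(k i).2.1 - (k j).2.1‖])
  obtain ⟨q, hq⟩ := cauchySeq_tendsto_of_complete (cauchySeq_of_sq_le (x := fun n => (k n).2.1)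
    fun i j N hi hj => by linarith [hdist i j N hi hj, sq_nonneg ‖(k i).1 - (k j).1‖])
  have hval : Tendsto (fun n => quadHeight (k n)) atTop (𝓝 m) := by
    refine tendsto_of_tendsto_of_tendsto_of_le_of_le tendsto_const_nhds ?_
      (fun n => hle _ (hk n)) (fun n => (hkm n).le)
    simpa using (tendsto_one_div_add_atTop_nhds_zero_nat (𝕜 := ℝ)).const_add m
  -- The limit height is forced by the limits of `quadHeight` and of the norms; (p, q, r) need not
  -- lie in the hull.
  set r := m - (‖p‖ ^ 2 + ‖q‖ ^ 2) / 2 with hr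
  have hrlim : Tendsto (fun n => (k n).2.2) atTop (𝓝 r) := by
    have := hval.sub (((hp.norm.pow 2).add (hq.norm.pow 2)).div_const 2)
    refine this.congr fun n => ?_
    simp only [quadHeight]
    ring
  have hpq : inner ℝ p q ≤ r :=
    le_of_tendsto_of_tendsto' (hp.inner hq) hrlim fun n => hB.inner_le_of_mem_liftedHull (hk n)
  have hvar : ∀ a b, b ∈ B a → ‖p + q‖ ^ 2 ≤ inner ℝ (-q - a) (-p - b) := by
    intro a b hab
    have hD : 0 ≤ inner ℝ a b - r + inner ℝ p (a - p) + inner ℝ q (b - q) := by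
      -- For fixed `t`, let n → ∞ in the minimality of `m` along the segment towards (a, b, ⟨a, b⟩);
      -- then divide by `t` and let t → 0.
      refine nonneg_of_forall_add_mul_nonneg
        (E := (‖a - p‖ ^ 2 + ‖b - q‖ ^ 2) / 2) fun t ht ht1 => ?_
      have hlim : Tendsto (fun n => quadHeight (k n)
          + t * (inner ℝ a b - (k n).2.2 + inner ℝ (k n).1 (a - (k n).1)
            + inner ℝ (k n).2.1 (b - (k n).2.1))
          + t ^ 2 / 2 * (‖a - (k n).1‖ ^ 2 + ‖b - (k n).2.1‖ ^ 2)) atTop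
          (𝓝 (m + t * (inner ℝ a b - r + inner ℝ p (a - p) + inner ℝ q (b - q))
            + t ^ 2 / 2 * (‖a - p‖ ^ 2 + ‖b - q‖ ^ 2))) :=
        (hval.add ((((hrlim.const_sub _).add (hp.inner (hp.const_sub a))).add
          (hq.inner (hq.const_sub b))).const_mul t)).add
          ((((hp.const_sub a).norm.pow 2).add ((hq.const_sub b).norm.pow 2)).const_mul _)
      have h := ge_of_tendsto' hlim fun n => by
        have := hle _ (hcomb _ (hk n) _ (hmem a b hab) t ht ht1)
        rwa [quadHeight_convexComb] at this
      refine nonneg_of_mul_nonneg_right ?_ ht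
      linarith
    simp only [inner_sub_left, inner_sub_right, inner_neg_left, inner_neg_right,
      real_inner_self_eq_norm_sq] at hD ⊢
    rw [norm_add_sq_real]
    have := real_inner_comm p q
    have := real_inner_comm p a
    linarith
  have hgraph : -p ∈ B (-q) := (hB (-q) (-p)).2 fun c hc =>
    (sq_nonneg _).trans (hvar c.1 c.2 hc)
  have h0 := hvar _ _ hgraph
  rw [sub_self, inner_zero_left] at h0
  have h1 : p + q = 0 := by
    rw [← norm_eq_zero]
    exact pow_eq_zero_iff two_ne_zero |>.1 (le_antisymm h0 (sq_nonneg _))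
  rw [← eq_neg_of_add_eq_zero_left h1] at hgraph
  exact ⟨p, hgraph⟩

/-- **Minty's theorem**: `B + Id` is surjective. -/
theorem IsMaximallyMonotone.exists_sub_mem {B : SetOp G G} (hB : IsMaximallyMonotone B) (w : G) :
    ∃ x, w - x ∈ B x := by
  have : IsMaximallyMonotone (fun x => {u | u + w ∈ B x} : SetOp G G) := by
    intro x u
    refine (hB x (u + w)).trans ⟨fun h c hc => ?_, fun h c hc => ?_⟩
    · simpa using h (c.1, c.2 + w) hc
    · simpa [sub_sub_eq_add_sub] using h (c.1, c.2 - w) (by simpa [graph] using hc)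
  obtain ⟨x, hx⟩ := this.exists_neg_mem
  exact ⟨x, by simpa [sub_eq_neg_add] using hx⟩

end Minty

/-! ### Firmly nonexpansive maps and the Brezis–Haraux range theorem. -/

/-- `⟪x - y, T x - T y⟫ ≥ ‖T x - T y‖²` for all `x` and `y`. -/
def FirmlyNonexpansive {H : Type*} [NormedAddCommGroup H] [InnerProductSpace ℝ H]
    (T : H → H) : Prop :=
  ∀ x y, ‖T x - T y‖ ^ 2 ≤ inner ℝ (x - y) (T x - T y)

section Firm

variable {H : Type*} [NormedAddCommGroup H] [InnerProductSpace ℝ H] {T : H → H}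

lemma FirmlyNonexpansive.id_sub (hT : FirmlyNonexpansive T) :
    FirmlyNonexpansive (fun x => x - T x) := by
  intro x y
  have h := hT x y
  have e : x - T x - (y - T y) = (x - y) - (T x - T y) := by abel
  simp only [e]
  rw [norm_sub_sq_real (x - y), inner_sub_right (x - y) (x - y), real_inner_self_eq_norm_sq]
  linarith

lemma FirmlyNonexpansive.norm_sub_le (hT : FirmlyNonexpansive T) (x y : H) :
    ‖T x - T y‖ ≤ ‖x - y‖ := by
  by_contra! h
  have h1 := (hT x y).trans (real_inner_le_norm _ _)
  nlinarith [norm_nonneg (x - y)]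

lemma FirmlyNonexpansive.inner_nonneg (hT : FirmlyNonexpansive T) (x y : H) :
    0 ≤ inner ℝ (x - y) (T x - T y) := (sq_nonneg _).trans (hT x y)

lemma FirmlyNonexpansive.continuous (hT : FirmlyNonexpansive T) : Continuous T :=
  (LipschitzWith.of_dist_le_mul (K := 1) fun x y => by
    simpa [dist_eq_norm] using hT.norm_sub_le x y).continuous

/-- An operator whose resolvent is an everywhere defined firmly nonexpansive map is maximally
monotone. -/
lemma FirmlyNonexpansive.isMaximallyMonotone (hT : FirmlyNonexpansive T) {A : SetOp H H}
    (hA : ∀ x u, u ∈ A x ↔ T (x + u) = x) : IsMaximallyMonotone A := by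
  intro x u
  constructor
  · rintro h ⟨x', u'⟩ h'
    have h1 : T (x + u) = x := (hA x u).1 h
    have h2 : T (x' + u') = x' := (hA x' u').1 h'
    have h3 := hT (x + u) (x' + u')
    have e : x + u - (x' + u') = (x - x') + (u - u') := by abel
    rw [h1, h2, e, inner_add_left, real_inner_self_eq_norm_sq, real_inner_comm] at h3
    linarith
  · intro h
    -- Against this graph point the pairing equals −‖x − T(x + u)‖².
    have h1 := h (T (x + u), x + u - T (x + u)) ((hA _ _).2 (by simp))
    have e : u - (x + u - T (x + u)) = -(x - T (x + u)) := by abel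
    simp only [e, inner_neg_right, real_inner_self_eq_norm_sq] at h1
    have h2 : ‖x - T (x + u)‖ = 0 :=
      pow_eq_zero_iff two_ne_zero |>.1 (le_antisymm (by linarith) (sq_nonneg _))
    exact (hA x u).2 (sub_eq_zero.1 (norm_eq_zero.1 h2)).symm

/-- Squared-norm monotonicity of the Tikhonov curve `ε • x + T x = y`. -/
lemma FirmlyNonexpansive.tikhonov_sq_le (hT : FirmlyNonexpansive T) {a b y : H} {ε δ : ℝ}
    (hδ : 0 < δ) (hδε : δ ≤ ε) (ha : ε • a + T a = y) (hb : δ • b + T b = y) :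
    ‖a - b‖ ^ 2 ≤ ‖b‖ ^ 2 - ‖a‖ ^ 2 := by
  have h := hT.inner_nonneg a b
  have e : T a - T b = -(δ • (a - b) + (ε - δ) • a) := by
    rw [eq_sub_of_add_eq' ha, eq_sub_of_add_eq' hb]
    module
  rw [e, inner_neg_right, inner_add_right, inner_smul_right, inner_smul_right,
    real_inner_self_eq_norm_sq] at h
  have h1 : ‖a - b‖ ^ 2 = ‖b‖ ^ 2 - ‖a‖ ^ 2 + 2 * inner ℝ (a - b) a := by
    rw [norm_sub_sq_real, inner_sub_left, real_inner_self_eq_norm_sq, real_inner_comm]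
    ring
  rcases hδε.eq_or_lt with rfl | hlt
  · have h2 : ‖a - b‖ ^ 2 ≤ 0 := by
      by_contra! h3
      nlinarith
    have h4 : a = b := by
      rw [← sub_eq_zero, ← norm_eq_zero]
      exact pow_eq_zero_iff two_ne_zero |>.1 (le_antisymm h2 (sq_nonneg _))
    simp [h4]
  · have h2 : inner ℝ (a - b) a ≤ 0 := by
      by_contra! h3
      nlinarith [mul_pos (sub_pos.2 hlt) h3, mul_nonneg hδ.le (sq_nonneg ‖a - b‖)]
    linarith

variable [CompleteSpace H]

/-- The equation reads x = (1 + ε)⁻¹((x − Tx) + y), a contraction since Id − T is nonexpansive. -/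
lemma FirmlyNonexpansive.exists_tikhonov (hT : FirmlyNonexpansive T) {ε : ℝ} (hε : 0 < ε) (y : H) :
    ∃ x, ε • x + T x = y := by
  have h1ε : 0 < 1 + ε := by linarith
  have hK : ContractingWith (Real.toNNReal (1 + ε)⁻¹)
      (fun x => (1 + ε)⁻¹ • ((x - T x) + y)) := by
    refine ⟨?_, LipschitzWith.of_dist_le_mul fun x z => ?_⟩
    · rw [Real.toNNReal_lt_one]
      exact inv_lt_one_of_one_lt₀ (by linarith)
    · rw [dist_eq_norm, dist_eq_norm, ← smul_sub, add_sub_add_right_eq_sub, norm_smul,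
        Real.norm_of_nonneg (by positivity), Real.coe_toNNReal _ (by positivity)]
      exact mul_le_mul_of_nonneg_left (hT.id_sub.norm_sub_le x z) (by positivity)
  have hfix : (1 + ε)⁻¹ • ((_ - T _) + y) = _ := hK.fixedPoint_isFixedPt
  set x := hK.fixedPoint
  refine ⟨x, ?_⟩
  have h2 : (x - T x) + y = (1 + ε) • x := by
    rw [← hfix, smul_smul, mul_inv_cancel₀ h1ε.ne', one_smul, hfix]
  have h3 : y = (1 + ε) • x - (x - T x) := eq_sub_of_add_eq' h2
  rw [h3]
  module

lemma FirmlyNonexpansive.exists_tikhonov_seq (hT : FirmlyNonexpansive T) (y : H) :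
    ∃ x : ℕ → H, ∀ n : ℕ, (1 / ((n : ℝ) + 1)) • x n + T (x n) = y :=
  ⟨_, fun _ => (hT.exists_tikhonov Nat.one_div_pos_of_nat y).choose_spec⟩

/-- **Brezis–Haraux**, closure part. -/
lemma FirmlyNonexpansive.mem_closure_range (hT : FirmlyNonexpansive T) {y : H}
    (hy : ∃ c : ℝ, ∀ x, -c ≤ inner ℝ x (T x - y)) : y ∈ closure (Set.range T) := by
  obtain ⟨c, hc⟩ := hy
  obtain ⟨x, hx⟩ := hT.exists_tikhonov_seq y
  -- Since T xₙ − y = −ε xₙ, the lower bound says ε‖xₙ‖² ≤ c, that is ‖ε xₙ‖² ≤ cε.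
  have hdist : ∀ n, ‖T (x n) - y‖ ≤ √(c * (1 / ((n : ℝ) + 1))) := by
    intro n
    have hε : 0 < 1 / ((n : ℝ) + 1) := Nat.one_div_pos_of_nat
    have h := hc (x n)
    set ε := 1 / ((n : ℝ) + 1)
    have e : T (x n) - y = -(ε • x n) := by rw [← hx n]; abel
    rw [e, inner_neg_right, inner_smul_right, real_inner_self_eq_norm_sq] at h
    rw [e, norm_neg, norm_smul, Real.norm_of_nonneg hε.le]
    refine Real.le_sqrt_of_sq_le ?_
    nlinarith
  have hlim : Tendsto (fun n => T (x n)) atTop (𝓝 y) := by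
    rw [tendsto_iff_norm_sub_tendsto_zero]
    refine squeeze_zero (fun _ => norm_nonneg _) hdist ?_
    simpa using ((tendsto_one_div_add_atTop_nhds_zero_nat (𝕜 := ℝ)).const_mul c).sqrt
  exact mem_closure_of_tendsto hlim (Eventually.of_forall fun n => Set.mem_range_self _)

/-- **Brezis–Haraux**, interior part. -/
lemma FirmlyNonexpansive.mem_range_of_mem_interior (hT : FirmlyNonexpansive T) {R : Set H}
    (hR : ∀ y ∈ R, ∃ c : ℝ, ∀ x, -c ≤ inner ℝ x (T x - y)) {y : H} (hy : y ∈ interior R) :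
    y ∈ Set.range T := by
  obtain ⟨r, hr, hball⟩ := Metric.mem_nhds_iff.1 (mem_interior_iff_mem_nhds.1 hy)
  obtain ⟨x, hx⟩ := hT.exists_tikhonov_seq y
  -- Interiority lets y be perturbed by every small `v`. This bounds (xₙ) weakly, hence in norm by
  -- Banach–Steinhaus.
  have hup : ∀ v : H, ‖v‖ < r → ∃ c : ℝ, ∀ n, inner ℝ (x n) v ≤ c := by
    intro v hv
    obtain ⟨c, hc⟩ := hR (y + v) (hball (by simpa using hv))
    refine ⟨c, fun n => ?_⟩
    have hε : 0 < 1 / ((n : ℝ) + 1) := Nat.one_div_pos_of_nat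
    have h := hc (x n)
    set ε := 1 / ((n : ℝ) + 1)
    have e : T (x n) - (y + v) = -(ε • x n) - v := by rw [← hx n]; abel
    rw [e, inner_sub_right, inner_neg_right, inner_smul_right, real_inner_self_eq_norm_sq] at h
    nlinarith [sq_nonneg ‖x n‖]
  have hpt : ∀ v : H, ∃ C : ℝ, ∀ n, ‖innerSL ℝ (x n) v‖ ≤ C := by
    intro v
    set t := r / (2 * (‖v‖ + 1)) with ht
    have hv := norm_nonneg v
    have ht0 : 0 < t := by positivity
    have htv : ‖t • v‖ < r := by
      rw [norm_smul, Real.norm_of_nonneg ht0.le, ht, div_mul_eq_mul_div,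
        div_lt_iff₀ (by positivity)]
      nlinarith
    obtain ⟨c, hc⟩ := hup (t • v) htv
    obtain ⟨d, hd⟩ := hup (-(t • v)) (by rwa [norm_neg])
    refine ⟨max c d / t, fun n => ?_⟩
    have h1 := hc n
    have h2 := hd n
    rw [inner_neg_right] at h2
    rw [inner_smul_right] at h1 h2
    rw [innerSL_apply_apply, Real.norm_eq_abs, le_div_iff₀ ht0]
    rcases abs_cases (inner ℝ (x n) v) with ⟨h3, -⟩ | ⟨h3, -⟩
    · rw [h3]
      linarith [le_max_left c d]
    · rw [h3]
      linarith [le_max_right c d]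
  obtain ⟨C, hC⟩ := banach_steinhaus hpt
  simp only [innerSL_apply_norm] at hC
  have hsq : ∀ n m, n ≤ m → ‖x n - x m‖ ^ 2 ≤ ‖x m‖ ^ 2 - ‖x n‖ ^ 2 := fun n m hnm =>
    hT.tikhonov_sq_le Nat.one_div_pos_of_nat (Nat.one_div_le_one_div hnm) (hx n) (hx m)
  have hmono : Monotone (fun n => ‖x n‖ ^ 2) := fun n m hnm => by
    have := hsq n m hnm
    have := sq_nonneg ‖x n - x m‖
    simp only
    linarith
  have hbdd : BddAbove (Set.range fun n => ‖x n‖ ^ 2) := by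
    refine ⟨C ^ 2, ?_⟩
    rintro _ ⟨n, rfl⟩
    exact pow_le_pow_left₀ (norm_nonneg _) (hC n) 2
  -- The squared norms increase and are bounded, hence converge, and `hsq` controls distances by
  -- their increments.
  have hcau : CauchySeq x := by
    rw [Metric.cauchySeq_iff']
    intro η hη
    obtain ⟨N, hN⟩ := Metric.cauchySeq_iff'.1 (tendsto_atTop_ciSup hmono hbdd).cauchySeq (η ^ 2)
      (by positivity)
    refine ⟨N, fun n hn => ?_⟩
    have h1 := hN n hn
    rw [Real.dist_eq] at h1
    have h2 := hsq N n hn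
    rw [dist_comm, dist_eq_norm]
    refine lt_of_pow_lt_pow_left₀ 2 hη.le ?_
    linarith [le_abs_self (‖x n‖ ^ 2 - ‖x N‖ ^ 2)]
  obtain ⟨z, hz⟩ := cauchySeq_tendsto_of_complete hcau
  refine ⟨z, tendsto_nhds_unique ((hT.continuous.tendsto z).comp hz) ?_⟩
  have h := ((tendsto_one_div_add_atTop_nhds_zero_nat (𝕜 := ℝ)).smul hz).const_sub y
  rw [zero_smul, sub_zero] at h
  exact h.congr fun n => (eq_sub_of_add_eq' (hx n)).symm

lemma FirmlyNonexpansive.interior_closure_range_eq (hT : FirmlyNonexpansive T) {R : Set H}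
    (hR : ∀ y ∈ R, ∃ c : ℝ, ∀ x, -c ≤ inner ℝ x (T x - y)) (hTR : Set.range T ⊆ R) :
    interior (Set.range T) = interior R ∧ closure (Set.range T) = closure R :=
  ⟨(interior_mono hTR).antisymm
    (interior_maximal (fun _ => hT.mem_range_of_mem_interior hR) isOpen_interior),
  (closure_mono hTR).antisymm
    (closure_minimal (fun _ hy => hT.mem_closure_range (hR _ hy)) isClosed_closure)⟩

end Firm

/-! ### Operators described by their resolvents. -/

section Resolvent

lemma domain_eq_range {G : Type*} [AddCommGroup G] {B : SetOp G G} {J : G → G}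
    (hJB : ∀ x u, u ∈ B x ↔ J (x + u) = x) : domain B = Set.range J := by
  ext x
  constructor
  · rintro ⟨u, hu⟩
    exact ⟨_, (hJB x u).1 hu⟩
  · rintro ⟨z, rfl⟩
    exact ⟨z - J z, (hJB _ _).2 (by simp)⟩

lemma ran_eq_range {G : Type*} [AddCommGroup G] {B : SetOp G G} {J : G → G}
    (hJB : ∀ x u, u ∈ B x ↔ J (x + u) = x) :
    ran B = Set.range (fun z => z - J z) := by
  ext u
  constructor
  · rintro ⟨x, hu⟩
    exact ⟨x + u, by simp [(hJB x u).1 hu]⟩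
  · rintro ⟨z, rfl⟩
    exact ⟨J z, (hJB _ _).2 (by simp)⟩

variable {G : Type*} [NormedAddCommGroup G] [InnerProductSpace ℝ G] [CompleteSpace G]

lemma IsMaximallyMonotone.exists_resolvent {B : SetOp G G} (hB : IsMaximallyMonotone B) :
    ∃ J : G → G, FirmlyNonexpansive J ∧ ∀ x u, u ∈ B x ↔ J (x + u) = x := by
  choose J hJ using hB.exists_sub_mem
  have hF : FirmlyNonexpansive J := fun x y => by
    have h := hB.monotone (hJ x) (hJ y)
    have e : x - J x - (y - J y) = (x - y) - (J x - J y) := by abel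
    rw [e, inner_sub_right, real_inner_self_eq_norm_sq, real_inner_comm] at h
    linarith
  refine ⟨J, hF, fun x u => ⟨fun h => ?_, fun h => ?_⟩⟩
  · have h1 := hB.monotone h (hJ (x + u))
    have e : u - (x + u - J (x + u)) = -(x - J (x + u)) := by abel
    rw [e, inner_neg_right, real_inner_self_eq_norm_sq] at h1
    have h2 : ‖x - J (x + u)‖ = 0 :=
      pow_eq_zero_iff two_ne_zero |>.1 (le_antisymm (by linarith) (sq_nonneg _))
    exact (sub_eq_zero.1 (norm_eq_zero.1 h2)).symm
  · have := hJ (x + u)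
    rwa [h, add_sub_cancel_left] at this

end Resolvent

/-! ### The resolvent L* ∘ J ∘ L and the assertions about L ⋄ B. -/

section Composition

lemma norm_apply_le_of_opNorm_le_one {H G : Type*} [NormedAddCommGroup H] [NormedSpace ℝ H]
    [NormedAddCommGroup G] [NormedSpace ℝ G] {L : H →L[ℝ] G} (hL : ‖L‖ ≤ 1) (x : H) : ‖L x‖ ≤ ‖x‖ := by
  simpa using L.le_of_opNorm_le hL x

variable {H G : Type*} [NormedAddCommGroup H] [InnerProductSpace ℝ H] [CompleteSpace H]
  [NormedAddCommGroup G] [InnerProductSpace ℝ G] [CompleteSpace G]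
  {L : H →L[ℝ] G} {B : SetOp G G} {J : G → G}

local notation "adj" => ContinuousLinearMap.adjoint

lemma mem_resolventComp_iff (hJB : ∀ x u, u ∈ B x ↔ J (x + u) = x) (x u : H) :
    u ∈ resolventComp L B x ↔ adj L (J (L (x + u))) = x := by
  have h1 : ∀ y w, w ∈ (B + ident G) y ↔ J w = y := by
    intro y w
    simp only [Pi.add_apply, ident, ofMap, id, Set.add_singleton, Set.mem_image]
    constructor
    · rintro ⟨v, hv, rfl⟩
      rw [add_comm]
      exact (hJB y v).1 hv
    · intro h
      exact ⟨w - y, (hJB _ _).2 (by simpa using h), by simp⟩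
  have h2 : ∀ v, v ∈ parallelComp L (B + ident G) x ↔ adj L (J (L v)) = x := by
    intro v
    simp only [parallelComp, inverse, comp, ofMap, Set.mem_ofPred_eq, Set.mem_iUnion,
      Set.mem_singleton_iff, exists_prop, exists_eq_left, h1]
    exact ⟨fun ⟨_, hy, hx⟩ => by rw [hy, hx], fun h => ⟨_, rfl, h.symm⟩⟩
  simp only [resolventComp, Pi.sub_apply, ident, ofMap, id, Set.sub_singleton, Set.mem_image]
  constructor
  · rintro ⟨v, hv, rfl⟩
    simpa using (h2 v).1 hv
  · intro h
    exact ⟨x + u, (h2 _).2 h, by simp⟩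

lemma norm_adjoint_apply_le (hL : ‖L‖ ≤ 1) (y : G) : ‖adj L y‖ ≤ ‖y‖ :=
  norm_apply_le_of_opNorm_le_one (by simpa using hL) y

lemma inner_adjoint_comp (x y : H) :
    inner ℝ (x - y) (adj L (J (L x)) - adj L (J (L y)))
      = inner ℝ (L x - L y) (J (L x) - J (L y)) := by
  rw [← map_sub (adj L), ContinuousLinearMap.adjoint_inner_right, map_sub]

lemma FirmlyNonexpansive.adjoint_comp (hL : ‖L‖ ≤ 1) (hJ : FirmlyNonexpansive J) :
    FirmlyNonexpansive (fun x => adj L (J (L x))) := by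
  intro x y
  rw [inner_adjoint_comp, ← map_sub (adj L)]
  exact (pow_le_pow_left₀ (norm_nonneg _) (norm_adjoint_apply_le hL _) 2).trans (hJ _ _)

/-- Firmly nonexpansive maps are 3* monotone, and this is kept by composition with `L`. -/
lemma FirmlyNonexpansive.le_inner_adjoint_comp (hJ : FirmlyNonexpansive J) (z : G) (x : H) :
    -(‖z‖ ^ 2 / 4) ≤ inner ℝ x (adj L (J (L x)) - adj L (J z)) := by
  rw [← map_sub (adj L), ContinuousLinearMap.adjoint_inner_right]
  have h1 := hJ (L x) z
  have h2 := abs_le.1 (abs_real_inner_le_norm z (J (L x) - J z))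
  rw [inner_sub_left] at h1
  -- With d = ‖J(Lx) − Jz‖ the pairing is at least d² − ‖z‖d; completing the square gives the
  -- constant.
  nlinarith [sq_nonneg (‖J (L x) - J z‖ - ‖z‖ / 2), h2.1]

lemma inner_id_sub_adjoint_comp_nonneg (hL : ‖L‖ ≤ 1) (x : H) :
    0 ≤ inner ℝ x (x - adj L (L x)) := by
  rw [inner_sub_right, ContinuousLinearMap.adjoint_inner_right, real_inner_self_eq_norm_sq,
    real_inner_self_eq_norm_sq]
  exact sub_nonneg.2 (pow_le_pow_left₀ (norm_nonneg _) (norm_apply_le_of_opNorm_le_one hL x) 2)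

/-- Complete the square for the positive self-adjoint S = Id − L*L: ⟨x, S(x − w)⟩ = ⟨x − w/2, S(x −
w/2)⟩ − ⟨w, Sw⟩/4. -/
lemma le_inner_id_sub_adjoint_comp (hL : ‖L‖ ≤ 1) (w x : H) :
    -(inner ℝ w (w - adj L (L w)) / 4) ≤ inner ℝ x ((x - adj L (L x)) - (w - adj L (L w))) := by
  have h := inner_id_sub_adjoint_comp_nonneg hL (x - (1 / 2 : ℝ) • w)
  simp only [map_sub, map_smul, inner_sub_left, inner_sub_right, inner_smul_left,
    inner_smul_right, ContinuousLinearMap.adjoint_inner_right, RCLike.conj_to_real] at h ⊢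
  rw [real_inner_comm x w, real_inner_comm (L x) (L w)] at h
  linarith

lemma resolventComp_isMaximallyMonotone (hL : ‖L‖ ≤ 1) (hB : IsMaximallyMonotone B) :
    IsMaximallyMonotone (resolventComp L B) := by
  obtain ⟨J, hJ, hJB⟩ := hB.exists_resolvent
  exact (hJ.adjoint_comp hL).isMaximallyMonotone (mem_resolventComp_iff hJB)

lemma resolventComp_atMostSingleValued (hB : IsMaximallyMonotone B)
    (hLi : Function.Injective L) (hBs : AtMostSingleValued B) :
    AtMostSingleValued (resolventComp L B) := by
  obtain ⟨J, hJ, hJB⟩ := hB.exists_resolvent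
  intro x u hu v hv
  rw [mem_resolventComp_iff hJB] at hu hv
  have h1 := inner_adjoint_comp (L := L) (J := J) (x + u) (x + v)
  rw [hu, hv, sub_self, inner_zero_right] at h1
  have h2 := hJ (L (x + u)) (L (x + v))
  rw [← h1] at h2
  -- L*JL agrees at both points, so firm nonexpansiveness of `J` makes `J` itself agree there.
  have h3 : J (L (x + u)) = J (L (x + v)) := by
    rw [← sub_eq_zero, ← norm_eq_zero]
    exact pow_eq_zero_iff two_ne_zero |>.1 (le_antisymm h2 (sq_nonneg _))
  have h4 : L (x + u) - J (L (x + u)) ∈ B (J (L (x + u))) := (hJB _ _).2 (by simp)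
  have h5 : L (x + v) - J (L (x + u)) ∈ B (J (L (x + u))) := by
    rw [h3]; exact (hJB _ _).2 (by simp)
  exact add_left_cancel (hLi (sub_left_injective (hBs _ h4 h5)))

lemma resolventComp_isInjective (hL : ‖L‖ ≤ 1) (hB : IsMaximallyMonotone B)
    (hBi : IsInjective B) :
    IsInjective (resolventComp L B) := by
  obtain ⟨J, hJ, hJB⟩ := hB.exists_resolvent
  rintro x y ⟨u, hu, hv⟩
  rw [mem_resolventComp_iff hJB] at hu hv
  have h1 := inner_adjoint_comp (L := L) (J := J) (x + u) (y + u)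
  have h2 := hJ (L (x + u)) (L (y + u))
  rw [hu, hv, add_sub_add_right_eq_sub, real_inner_self_eq_norm_sq] at h1
  have h3 : L (x + u) - L (y + u) = L (x - y) := by rw [← map_sub]; simp
  have h4 := pow_le_pow_left₀ (norm_nonneg _) (norm_apply_le_of_opNorm_le_one hL (x - y)) 2
  rw [← h3] at h4
  -- With Δ the difference of the `J` values, ⟨L(x − y), Δ⟩ = ‖x − y‖² dominates both ‖L(x − y)‖²
  -- and ‖Δ‖², which forces L(x − y) = Δ.
  have h5 : L (x + u) - L (y + u) - (J (L (x + u)) - J (L (y + u))) = 0 := by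
    rw [← norm_eq_zero]
    refine pow_eq_zero_iff two_ne_zero |>.1 (le_antisymm ?_ (sq_nonneg _))
    rw [norm_sub_sq_real]
    linarith
  have h6 : L (x + u) - J (L (x + u)) = L (y + u) - J (L (y + u)) := by
    rw [← sub_eq_zero, ← h5]; abel
  have h7 : L (x + u) - J (L (x + u)) ∈ B (J (L (x + u))) := (hJB _ _).2 (by simp)
  have h8 : L (x + u) - J (L (x + u)) ∈ B (J (L (y + u))) := by
    rw [h6]; exact (hJB _ _).2 (by simp)
  rw [← hu, ← hv, hBi _ _ ⟨_, h7, h8⟩]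

lemma interior_closure_domain_resolventComp (hL : ‖L‖ ≤ 1) (hB : IsMaximallyMonotone B) :
    interior (domain (resolventComp L B)) = interior (adj L '' domain B) ∧
    closure (domain (resolventComp L B)) = closure (adj L '' domain B) := by
  obtain ⟨J, hJ, hJB⟩ := hB.exists_resolvent
  rw [domain_eq_range hJB,
    domain_eq_range (J := fun x => adj L (J (L x))) (mem_resolventComp_iff hJB)]
  refine (hJ.adjoint_comp hL).interior_closure_range_eq ?_ ?_
  · rintro _ ⟨_, ⟨z, rfl⟩, rfl⟩
    exact ⟨_, hJ.le_inner_adjoint_comp z⟩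
  · rintro _ ⟨x, rfl⟩
    exact ⟨_, ⟨_, rfl⟩, rfl⟩

lemma interior_closure_ran_resolventComp (hL : ‖L‖ ≤ 1) (hB : IsMaximallyMonotone B) :
    interior (ran (resolventComp L B)) =
      interior (Set.range (ContinuousLinearMap.id ℝ H - (adj L).comp L) + adj L '' ran B) ∧
    closure (ran (resolventComp L B)) =
      closure (Set.range (ContinuousLinearMap.id ℝ H - (adj L).comp L) + adj L '' ran B) := by
  obtain ⟨J, hJ, hJB⟩ := hB.exists_resolvent
  rw [ran_eq_range hJB,
    ran_eq_range (J := fun x => adj L (J (L x))) (mem_resolventComp_iff hJB)]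
  have hsplit : ∀ x, x - adj L (J (L x)) = (x - adj L (L x)) + adj L (L x - J (L x)) := by
    intro x
    rw [map_sub]
    abel
  refine (hJ.adjoint_comp hL).id_sub.interior_closure_range_eq ?_ ?_
  · rintro _ ⟨_, ⟨w, rfl⟩, _, ⟨_, ⟨z, rfl⟩, rfl⟩, rfl⟩
    refine ⟨inner ℝ w (w - adj L (L w)) / 4 + ‖z‖ ^ 2 / 4, fun x => ?_⟩
    have h1 := le_inner_id_sub_adjoint_comp hL w x
    have h2 := hJ.id_sub.le_inner_adjoint_comp (L := L) z x
    simp only [hsplit x, _root_.sub_apply, ContinuousLinearMap.id_apply,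
      ContinuousLinearMap.comp_apply, add_sub_add_comm]
    rw [inner_add_right]
    linarith
  · rintro _ ⟨x, rfl⟩
    exact ⟨_, ⟨x, rfl⟩, _, ⟨_, ⟨L x, rfl⟩, rfl⟩, (hsplit x).symm⟩

end Composition

end SetOp

theorem theorem4p5 {H G : Type*}
    [NormedAddCommGroup H] [InnerProductSpace ℝ H] [CompleteSpace H]
    [NormedAddCommGroup G] [InnerProductSpace ℝ G] [CompleteSpace G]
    (L : H →L[ℝ] G) (hL : ‖L‖ ≤ 1) (B : SetOp G G) (hB : SetOp.IsMaximallyMonotone B) :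
    SetOp.IsMaximallyMonotone (SetOp.resolventComp L B) ∧
    SetOp.IsMaximallyMonotone (SetOp.resolventCocomp L B) ∧
    (Function.Injective L → SetOp.AtMostSingleValued B →
      SetOp.AtMostSingleValued (SetOp.resolventComp L B)) ∧
    (Function.Injective L → SetOp.IsInjective B →
      SetOp.IsInjective (SetOp.resolventComp L B)) ∧
    interior (SetOp.domain (SetOp.resolventComp L B)) =
      interior (ContinuousLinearMap.adjoint L '' SetOp.domain B) ∧
    closure (SetOp.domain (SetOp.resolventComp L B)) =
      closure (ContinuousLinearMap.adjoint L '' SetOp.domain B) ∧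
    interior (SetOp.ran (SetOp.resolventComp L B)) =
      interior (Set.range (ContinuousLinearMap.id ℝ H - (ContinuousLinearMap.adjoint L).comp L) +
        ContinuousLinearMap.adjoint L '' SetOp.ran B) ∧
    closure (SetOp.ran (SetOp.resolventComp L B)) =
      closure (Set.range (ContinuousLinearMap.id ℝ H - (ContinuousLinearMap.adjoint L).comp L) +
        ContinuousLinearMap.adjoint L '' SetOp.ran B) ∧
    interior (SetOp.domain (SetOp.resolventCocomp L B)) =
      interior (Set.range (ContinuousLinearMap.id ℝ H - (ContinuousLinearMap.adjoint L).comp L) +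
        ContinuousLinearMap.adjoint L '' SetOp.domain B) ∧
    closure (SetOp.domain (SetOp.resolventCocomp L B)) =
      closure (Set.range (ContinuousLinearMap.id ℝ H - (ContinuousLinearMap.adjoint L).comp L) +
        ContinuousLinearMap.adjoint L '' SetOp.domain B) ∧
    interior (SetOp.ran (SetOp.resolventCocomp L B)) =
      interior (ContinuousLinearMap.adjoint L '' SetOp.ran B) ∧
    closure (SetOp.ran (SetOp.resolventCocomp L B)) =
      closure (ContinuousLinearMap.adjoint L '' SetOp.ran B) := by
  have hd := SetOp.interior_closure_domain_resolventComp hL hB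
  have hr := SetOp.interior_closure_ran_resolventComp hL hB
  -- Inversion exchanges domain and range by definition, so these also serve for the cocomposition.
  have hd' := SetOp.interior_closure_domain_resolventComp hL hB.inverse
  have hr' := SetOp.interior_closure_ran_resolventComp hL hB.inverse
  exact ⟨SetOp.resolventComp_isMaximallyMonotone hL hB,
    (SetOp.resolventComp_isMaximallyMonotone hL hB.inverse).inverse,
    SetOp.resolventComp_atMostSingleValued hB,
    fun _ => SetOp.resolventComp_isInjective hL hB,
    hd.1, hd.2, hr.1, hr.2, hr'.1, hr'.2, hd'.1, hd'.2⟩
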